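/- Let $\mathcal T$ be a triangulated category with shift $[1]$ that has arbitrary set-indexed coproducts; all subcategories are strict and full. For an object $T$ put $T^{\perp_{>0}}=\{Y : \mathrm{Hom}(T,Y[i])=0 \text{ for all } i>0\}$ and $T^{\perp_{\le 0}}=\{Y : \mathrm{Hom}(T,Y[i])=0 \text{ for all } i\le 0\}$. A t-structure is written as a pair $(\mathcal V,\mathcal W)$ with $\mathrm{Hom}(\mathcal V,\mathcal W)=0$, $\mathcal V[1]\subseteq\mathcal V$, and such that every object $X$ lies in a triangle $v(X)\to X\to w(X)\to v(X)[1]$ with $v(X)\in\mathcal V$ and $w(X)\in\mathcal W$ (both classes being closed under direct summands); $\mathcal V$ is called its aisle and $v(X)$, unique up to isomorphism, the truncation of $X$. The object $T$ is called silting if $(T^{\perp_{>0}},T^{\perp_{\le 0}})$ is a t-structure. Let $T$ be a silting object, with silting t-structure $(\mathcal V,\mathcal W)=(T^{\perp_{>0}},T^{\perp_{\le 0}})$. Then: 1. $\mathcal V=\mathsf{Susp}(T)$, the smallest subcategory of $\mathcal T$ that contains $T$ and is closed under extensions, positive shifts and coproducts; moreover, $\mathcal V$ is the smallest aisle of a t-structure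 in $\mathcal T$ that contains $T$. 2. For every object $X$ of $\mathcal T$ the truncation $v(X)$ is a Milnor colimit of a sequence $V_0\xrightarrow{f_1}V_1\xrightarrow{f_2}V_2\to\cdots$, where $V_0$ is a coproduct of copies of $T$ and, for each $n\ge 1$, the cone of $f_n: V_{n-1}\to V_n$ is a coproduct of copies of $T[n]$. Here a Milnor colimit of the sequence is a cone of the morphism $1-f:\coprod_{n\ge 0}V_n\to\coprod_{n\ge 0}V_n$, where $f$ sends the summand $V_{n-1}$ to $V_n$ by $f_n$. 3. Let $\mathcal U={}^{\perp_0}\mathcal V=\{Y : \mathrm{Hom}(Y,V)=0 \text{ for all } V\in\mathcal V\}$. Then $\mathcal U[1]\cap\mathcal V=\mathrm{Add}(T)$, the smallest subcategory of $\mathcal T$ that contains $T$ and is closed under coproducts and direct summands. -/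

import Mathlib

open CategoryTheory CategoryTheory.Limits CategoryTheory.Pretriangulated

universe v u

namespace Silting

section Basic

variable {C : Type u} [Category.{v} C] [Preadditive C] [HasZeroObject C] [HasShift C ℤ]
  [∀ n : ℤ, (shiftFunctor C n).Additive] [Pretriangulated C]

/-- The right orthogonal class of `P` for a set `I` of integers: all `Y` with
`Hom(X, Y[i]) = 0` for all `X` in `P` and all `i ∈ I`. -/
def rightPerp (P : ObjectProperty C) (I : Set ℤ) : ObjectProperty C :=
  fun Y => ∀ X : C, P X → ∀ i ∈ I, ∀ f : X ⟶ Y⟦i⟧, f = 0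

/-- The left orthogonal class of `P` for a set `I` of integers: all `Y` with
`Hom(Y, X[i]) = 0` for all `X` in `P` and all `i ∈ I`. -/
def leftPerp (P : ObjectProperty C) (I : Set ℤ) : ObjectProperty C :=
  fun Y => ∀ X : C, P X → ∀ i ∈ I, ∀ f : Y ⟶ X⟦i⟧, f = 0

/-- `(V, W)` is a t-structure, written as a pair (aisle, coaisle) with `Hom(V, W) = 0`.
In the cohomological indexing this is the pair of the classes `≤ 0` and `≥ 1`. -/
def IsTStructure (V W : ObjectProperty C) : Prop :=
  ∃ t : Triangulated.TStructure C, t.le 0 = V ∧ t.ge 1 = W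

/-- `V` is the aisle of some t-structure. -/
def IsAisle (V : ObjectProperty C) : Prop :=
  ∃ W : ObjectProperty C, IsTStructure V W

/-- The class of all `Y` with `Hom(T, Y[i]) = 0` for all `i > 0`. -/
def siltingAisle (T : C) : ObjectProperty C :=
  rightPerp (ObjectProperty.singleton T) (Set.Ioi 0)

/-- The class of all `Y` with `Hom(T, Y[i]) = 0` for all `i ≤ 0`. -/
def siltingCoaisle (T : C) : ObjectProperty C :=
  rightPerp (ObjectProperty.singleton T) (Set.Iic 0)

/-- `T` is a silting object. -/
def IsSilting (T : C) : Prop :=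
  IsTStructure (siltingAisle T) (siltingCoaisle T)

/-- A (strict, full) subcategory is suspended if it is closed under extensions and
positive shifts. -/
structure IsSuspended (P : ObjectProperty C) : Prop where
  closed_iso : P.IsClosedUnderIsomorphisms
  closed_ext : P.IsTriangulatedClosed₂
  closed_shift : ∀ n : ℤ, 0 < n → P.IsStableUnderShiftBy n

/-- A class of objects is closed under all existing set-indexed coproducts. -/
def IsClosedUnderCoproducts (P : ObjectProperty C) : Prop :=
  ∀ J : Type v, P.IsClosedUnderColimitsOfShape (Discrete J)

/-- The smallest suspended subcategory that contains `P` and is closed under all existing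
coproducts. -/
def susp (P : ObjectProperty C) : ObjectProperty C :=
  sInf {Q | IsSuspended Q ∧ IsClosedUnderCoproducts Q ∧ P ≤ Q}

/-- The smallest subcategory that contains `P` and is closed under coproducts and direct
summands. -/
def addClosure (P : ObjectProperty C) : ObjectProperty C :=
  sInf {Q | IsClosedUnderCoproducts Q ∧ Q.IsStableUnderRetracts ∧ P ≤ Q}

/-- `M` is a coproduct of a set-indexed family of copies of `S`. -/
def IsCoproductOfCopies (S M : C) : Prop :=
  ∃ (J : Type v) (c : Cofan fun _ : J => S), Nonempty (IsColimit c) ∧ Nonempty (c.pt ≅ M)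

/-- `M` is a Milnor colimit of `X 0 ⟶ X 1 ⟶ X 2 ⟶ ⋯`: a cone of the endomorphism
`1 - f` of the coproduct of all `X n`, where `f` sends `X n` to `X (n + 1)` by `f n`. -/
def IsMilnorColimit (X : ℕ → C) (f : ∀ n, X n ⟶ X (n + 1)) (M : C) : Prop :=
  ∃ (c : Cofan X) (hc : IsColimit c) (p : c.pt ⟶ M) (d : M ⟶ c.pt⟦(1 : ℤ)⟧),
    Triangle.mk (𝟙 c.pt - Cofan.IsColimit.desc hc fun n => f n ≫ c.inj (n + 1)) p d
      ∈ distTriang C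

/-- `A` is a truncation of `X` with respect to the aisle of `(V, W)`: it is the first term of a
triangle `A ⟶ X ⟶ B ⟶ A[1]` with `A` in `V` and `B` in `W`. If `(V, W)` is a
t-structure, then `A` is unique up to isomorphism and is the value at `X` of the right adjoint of
the inclusion of `V`. -/
def IsTruncation (V W : ObjectProperty C) (X A : C) : Prop :=
  V A ∧ ∃ (B : C) (f : A ⟶ X) (g : X ⟶ B) (h : B ⟶ A⟦(1 : ℤ)⟧),
    W B ∧ Triangle.mk f g h ∈ distTriang C

end Basic

end Silting

/-!
Let `t` be the silting t-structure of `T`, so that `X` lies in `t.le (-k)` if and only if no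
`T⟦j⟧` with `j < k` has a nonzero map to `X`. Hence, for `X` in `t.le (-k)`, the evaluation map from
the coproduct of copies of `T⟦k⟧` indexed by `Hom(T⟦k⟧, X)` has its cone in `t.le (-(k + 1))`.
Starting from `A` in the aisle and applying this to one cone after the other, the octahedral axiom
gives a sequence `Y 0 ⟶ Y 1 ⟶ ⋯` over `A` in which the cone of `Y n ⟶ A` lies in `t.le (-(n + 1))`.

There is no exactness of countable coproducts to prove that `A` is the Milnor colimit `M` of this
sequence. Instead one maps into an object `W` of `t.ge m`: the maps `Hom(A, W) ⟶ Hom(Y n, W)` are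
bijective for large `n`, so the `lim¹` term in the Milnor sequence for `Hom(M, W)` vanishes and
`Hom(A, W) ⟶ Hom(M, W)` is bijective. Since `t.ge m` is stable under negative shifts, the cone of
`M ⟶ A` is left orthogonal to every `t.ge m`, that is, it lies in every `t.le n`. An object of every
`t.le n` receives no nonzero map from any `T⟦j⟧`, so it lies in the coaisle as well as in the aisle,
and it is zero.

Any suspended class that contains `T` and is closed under coproducts contains such Milnor colimits,
hence the aisle. Finally, an object of the aisle that is left orthogonal to `t.le (-1)` is a retract
of its first approximation, a coproduct of copies of `T`.
-/

namespace Silting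

/-- `lim¹` vanishes for a sequence of abelian groups whose transition maps are eventually
surjective. -/
theorem exists_sub_map_succ_eq {G : ℕ → Type*} [∀ n, AddCommGroup (G n)]
    (ρ : ∀ n, G (n + 1) →+ G n) (N : ℕ) (hρ : ∀ n, N ≤ n → Function.Surjective (ρ n))
    (r : ∀ n, G n) : ∃ s : ∀ n, G n, ∀ n, s n - ρ n (s (n + 1)) = r n := by
  induction N generalizing G with
  | zero =>
    choose σ hσ using fun n => hρ n n.zero_le
    let s : ∀ n, G n := fun n => Nat.rec 0 (fun n x => σ n (x - r n)) n
    refine ⟨s, fun n => ?_⟩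
    change s n - ρ n (σ n (s n - r n)) = r n
    rw [hσ, sub_sub_cancel]
  | succ N ih =>
    obtain ⟨s, hs⟩ := ih (fun n => ρ (n + 1)) (fun n hn => hρ (n + 1) (Nat.succ_le_succ hn))
      fun n => r (n + 1)
    let s' : ∀ n, G n := fun n => Nat.casesOn n (r 0 + ρ 0 (s 0)) s
    refine ⟨s', fun n => ?_⟩
    cases n with
    | zero => exact add_sub_cancel_right _ _
    | succ n => exact hs n

section Category

variable {C : Type u} [Category.{v} C]

lemma eq_of_eq_of_injective_comp {Y : ℕ → C} {f : ∀ n, Y n ⟶ Y (n + 1)} {W : C} {N : ℕ}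
    (hf : ∀ n, N ≤ n → Function.Injective fun u : Y (n + 1) ⟶ W => f n ≫ u)
    {a b : ∀ n, Y n ⟶ W} (ha : ∀ n, f n ≫ a (n + 1) = a n) (hb : ∀ n, f n ≫ b (n + 1) = b n)
    (hN : a N = b N) (n : ℕ) : a n = b n := by
  obtain hn | hn := le_total N n
  · induction n, hn using Nat.le_induction with
    | base => exact hN
    | succ n hn ih => exact hf n hn (by simpa only [ha, hb] using ih)
  · induction hn using Nat.decreasingInduction with
    | self => exact hN
    | of_succ n _ ih => rw [← ha, ← hb, ih]

lemma IsClosedUnderCoproducts.prop_pt {P : ObjectProperty C} (hP : IsClosedUnderCoproducts P)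
    {β : Type*} [Small.{v} β] {X : β → C} {c : Cofan X} (hc : IsColimit c)
    (hX : ∀ b, P (X b)) : P c.pt := by
  have := hP (Shrink.{v} β)
  have : P.IsClosedUnderColimitsOfShape (Discrete β) :=
    .of_equivalence (Discrete.equivalence (equivShrink.{v} β).symm)
  exact P.prop_of_isColimit hc fun j => hX j.as

lemma IsCoproductOfCopies.prop {P : ObjectProperty C} (hP : IsClosedUnderCoproducts P)
    [P.IsClosedUnderIsomorphisms] {S M : C} (h : IsCoproductOfCopies S M) (hS : P S) : P M := by
  obtain ⟨J, c, ⟨hc⟩, ⟨e⟩⟩ := h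
  exact P.prop_of_iso e (hP.prop_pt hc fun _ => hS)

lemma IsCoproductOfCopies.of_iso {S S' M : C} (h : IsCoproductOfCopies S M) (e : S' ≅ S) :
    IsCoproductOfCopies S' M := by
  obtain ⟨J, c, ⟨hc⟩, hM⟩ := h
  exact ⟨J, _, ⟨(IsColimit.precomposeHomEquiv (Discrete.natIso fun _ => e) c).symm hc⟩, hM⟩

lemma isCoproductOfCopies_sigma {J : Type v} (S : C) [HasCoproduct fun _ : J => S] :
    IsCoproductOfCopies S (∐ fun _ : J => S) :=
  ⟨J, _, ⟨coproductIsCoproduct _⟩, ⟨Iso.refl _⟩⟩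

end Category

section LeftOrthogonal

variable {C : Type u} [Category.{v} C] [HasZeroMorphisms C] (P Q : ObjectProperty C)

instance leftOrthogonal_isClosedUnderColimitsOfShape (J : Type*) [Category* J] :
    P.leftOrthogonal.IsClosedUnderColimitsOfShape J where
  colimitsOfShape_le := fun _ ⟨p⟩ _ f hY =>
    p.isColimit.hom_ext fun j =>
      (p.prop_diag_obj j (p.ι.app j ≫ f) hY).trans comp_zero.symm

instance leftOrthogonal_isStableUnderRetracts : P.leftOrthogonal.IsStableUnderRetracts where
  of_retract r hY Z f hZ := by
    rw [← Category.id_comp f, ← r.retract, Category.assoc, hY (r.r ≫ f) hZ, comp_zero]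

lemma leftOrthogonal_isClosedUnderCoproducts : IsClosedUnderCoproducts P.leftOrthogonal :=
  fun _ => inferInstance

lemma leftOrthogonal_sup : (P ⊔ Q).leftOrthogonal = P.leftOrthogonal ⊓ Q.leftOrthogonal := by
  ext X
  exact ⟨fun h => ⟨fun _ f hY => h f (.inl hY), fun _ f hY => h f (.inr hY)⟩,
    fun h _ f hY => hY.elim (h.1 f) (h.2 f)⟩

variable [HasShift C ℤ]

lemma forall_hom_shift_eq_zero_iff {X X' : C} {a : ℤ} (e : X' ≅ X⟦a⟧) (Y : C) :
    (∀ f : X' ⟶ Y⟦a⟧, f = 0) ↔ ∀ f : X ⟶ Y, f = 0 := by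
  refine ⟨fun h f => (shiftFunctor C a).map_injective ?_, fun h f => ?_⟩
  · rw [Functor.map_zero, ← cancel_epi e.hom, h (e.hom ≫ f⟦a⟧'), comp_zero]
  · rw [← cancel_epi e.inv, comp_zero, ← (shiftFunctor C a).map_preimage (e.inv ≫ f),
      h ((shiftFunctor C a).preimage (e.inv ≫ f)), Functor.map_zero]

lemma leftOrthogonal_shift [P.IsClosedUnderIsomorphisms] (a : ℤ) :
    P.leftOrthogonal.shift a = (P.shift a).leftOrthogonal := by
  ext X
  constructor
  · intro h Y f hY
    exact (forall_hom_shift_eq_zero_iff (Iso.refl (X⟦a⟧)) Y).1 (fun g => h g hY) f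
  · intro h Y f hY
    let e : Y⟦-a⟧⟦a⟧ ≅ Y := shiftNegShift Y a
    have := (forall_hom_shift_eq_zero_iff (Iso.refl (X⟦a⟧)) (Y⟦-a⟧)).2
      (fun g => h g (P.prop_of_iso e.symm hY)) (f ≫ e.inv)
    rw [← cancel_mono e.inv, this, zero_comp]

end LeftOrthogonal

section Perp

variable {C : Type u} [Category.{v} C] [Preadditive C] [HasShift C ℤ]

lemma rightPerp_singleton_iff (T : C) (I : Set ℤ) (Y : C) :
    rightPerp (ObjectProperty.singleton T) I Y ↔ ∀ i ∈ I, ∀ f : T⟦-i⟧ ⟶ Y, f = 0 := by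
  refine ⟨fun h i hi => ?_, ?_⟩
  · exact (forall_hom_shift_eq_zero_iff (shiftNegShift T i).symm Y).1 (h T (by simp) i hi)
  · rintro h X hX i hi
    obtain rfl : T = X := by simpa using hX
    exact (forall_hom_shift_eq_zero_iff (shiftNegShift T i).symm Y).2 (h i hi)

lemma leftPerp_zero (P : ObjectProperty C) : leftPerp P {0} = P.leftOrthogonal := by
  ext X
  constructor
  · intro h Y f hY
    rw [← cancel_mono ((shiftFunctorZero C ℤ).inv.app Y), zero_comp]
    exact h Y hY 0 rfl _
  · rintro h Y hY _ rfl f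
    rw [← cancel_mono ((shiftFunctorZero C ℤ).hom.app Y), zero_comp]
    exact h _ hY

end Perp

section OneSubShift

variable {C : Type u} [Category.{v} C] [Preadditive C]

/-- The endomorphism `1 - f` of the coproduct of a sequence, whose cones are the Milnor colimits
of the sequence. -/
noncomputable def oneSubShift {Y : ℕ → C} (f : ∀ n, Y n ⟶ Y (n + 1)) {c : Cofan Y}
    (hc : IsColimit c) : c.pt ⟶ c.pt :=
  𝟙 c.pt - Cofan.IsColimit.desc hc fun n => f n ≫ c.inj (n + 1)

variable {Y : ℕ → C} {f : ∀ n, Y n ⟶ Y (n + 1)} {c : Cofan Y} {hc : IsColimit c} {W : C}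

lemma inj_oneSubShift_comp (u : c.pt ⟶ W) (n : ℕ) :
    c.inj n ≫ oneSubShift f hc ≫ u = c.inj n ≫ u - f n ≫ c.inj (n + 1) ≫ u := by
  simp [oneSubShift, Preadditive.sub_comp, Preadditive.comp_sub]

lemma surjective_oneSubShift_comp (N : ℕ)
    (hf : ∀ n, N ≤ n → Function.Surjective fun u : Y (n + 1) ⟶ W => f n ≫ u) :
    Function.Surjective fun u : c.pt ⟶ W => oneSubShift f hc ≫ u := by
  intro r
  obtain ⟨s, hs⟩ := exists_sub_map_succ_eq (fun n => Preadditive.leftComp W (f n)) N hf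
    fun n => c.inj n ≫ r
  refine ⟨Cofan.IsColimit.desc hc s, Cofan.IsColimit.hom_ext hc _ _ fun n => ?_⟩
  rw [inj_oneSubShift_comp, Cofan.IsColimit.fac, Cofan.IsColimit.fac]
  exact hs n

end OneSubShift

section Pretriangulated

variable {C : Type u} [Category.{v} C] [Preadditive C] [HasZeroObject C] [HasShift C ℤ]
  [∀ n : ℤ, (shiftFunctor C n).Additive] [Pretriangulated C]

section Local

variable {X Y Z W : C} {f : X ⟶ Y} {g : Y ⟶ Z} {h : Z ⟶ X⟦(1 : ℤ)⟧}

lemma eq_zero_of_comp_eq_zero_of_surjective (hT : Triangle.mk f g h ∈ distTriang C)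
    (hf : Function.Surjective fun v : Y ⟶ W⟦(-1 : ℤ)⟧ => f ≫ v) {u : Z ⟶ W} (hu : g ≫ u = 0) :
    u = 0 := by
  obtain ⟨w, rfl⟩ : ∃ w : X⟦(1 : ℤ)⟧ ⟶ W, u = h ≫ w := Triangle.yoneda_exact₃ _ hT u hu
  let e : W⟦(-1 : ℤ)⟧⟦(1 : ℤ)⟧ ≅ W := shiftNegShift W 1
  obtain ⟨v, hv : f ≫ v = _⟩ := hf ((shiftFunctor C (1 : ℤ)).preimage (w ≫ e.inv))
  have hw : f⟦(1 : ℤ)⟧' ≫ v⟦(1 : ℤ)⟧' = w ≫ e.inv := by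
    rw [← Functor.map_comp, hv, Functor.map_preimage]
  have hf₀ : h ≫ f⟦(1 : ℤ)⟧' = 0 := comp_distTriang_mor_zero₃₁ _ hT
  rw [← cancel_mono e.inv, Category.assoc, ← hw, reassoc_of% hf₀, zero_comp, zero_comp]

lemma isLocal_le_trW_leftOrthogonal (P : ObjectProperty C) [P.IsStableUnderShiftBy (-1 : ℤ)] :
    P.isLocal ≤ P.leftOrthogonal.trW := by
  intro X Y f hf
  obtain ⟨Z, g, h, hT⟩ := distinguished_cocone_triangle f
  refine ⟨Z, g, h, hT, fun W u hW => ?_⟩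
  refine eq_zero_of_comp_eq_zero_of_surjective hT (hf _ (P.le_shift (-1) _ hW)).surjective ?_
  have hfg : f ≫ g = 0 := comp_distTriang_mor_zero₁₂ _ hT
  exact (hf _ hW).injective (by simp only [reassoc_of% hfg, zero_comp, comp_zero])

end Local

section MilnorColimit

variable {Y : ℕ → C} {f : ∀ n, Y n ⟶ Y (n + 1)} {c : Cofan Y} {hc : IsColimit c} {A M W : C}
  {p : c.pt ⟶ M} {d : M ⟶ c.pt⟦(1 : ℤ)⟧}
variable (hM : Triangle.mk (oneSubShift f hc) p d ∈ distTriang C)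
include hM

lemma comp_inj_succ_comp_milnor (n : ℕ) : f n ≫ c.inj (n + 1) ≫ p = c.inj n ≫ p := by
  have h : oneSubShift f hc ≫ p = 0 := comp_distTriang_mor_zero₁₂ _ hM
  rw [eq_comm, ← sub_eq_zero, ← inj_oneSubShift_comp, h, comp_zero]

lemma exists_milnor_desc {y : ∀ n, Y n ⟶ A} (hy : ∀ n, f n ≫ y (n + 1) = y n) :
    ∃ φ : M ⟶ A, ∀ n, c.inj n ≫ p ≫ φ = y n := by
  have h : oneSubShift f hc ≫ Cofan.IsColimit.desc hc y = 0 :=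
    Cofan.IsColimit.hom_ext hc _ _ fun n => by
      rw [inj_oneSubShift_comp, Cofan.IsColimit.fac, Cofan.IsColimit.fac, hy, sub_self, comp_zero]
  obtain ⟨φ, hφ⟩ : ∃ φ : M ⟶ A, Cofan.IsColimit.desc hc y = p ≫ φ :=
    Triangle.yoneda_exact₂ _ hM _ h
  exact ⟨φ, fun n => by rw [← hφ, Cofan.IsColimit.fac]⟩

lemma milnor_hom_ext (N : ℕ)
    (hf : ∀ n, N ≤ n → Function.Surjective fun u : Y (n + 1) ⟶ W⟦(-1 : ℤ)⟧ => f n ≫ u)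
    {u v : M ⟶ W} (huv : ∀ n, c.inj n ≫ p ≫ u = c.inj n ≫ p ≫ v) : u = v := by
  refine sub_eq_zero.1 (eq_zero_of_comp_eq_zero_of_surjective hM
    (surjective_oneSubShift_comp N hf) (Cofan.IsColimit.hom_ext hc _ _ fun n => ?_))
  rw [Preadditive.comp_sub, Preadditive.comp_sub, huv, sub_self, comp_zero]

lemma isLocal_of_milnor (P : ObjectProperty C) [P.IsStableUnderShiftBy (-1 : ℤ)]
    {y : ∀ n, Y n ⟶ A} (hy : ∀ n, f n ≫ y (n + 1) = y n) (N : ℕ)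
    (hyP : ∀ n, N ≤ n → P.isLocal (y n)) {φ : M ⟶ A} (hφ : ∀ n, c.inj n ≫ p ≫ φ = y n) :
    P.isLocal φ := by
  have hf (n : ℕ) (hn : N ≤ n) : P.isLocal (f n) :=
    P.isLocal.of_postcomp _ _ (hyP (n + 1) (by lia)) (by rw [hy]; exact hyP n hn)
  intro W hW
  constructor
  · intro u v huv
    refine (hyP N le_rfl W hW).injective ?_
    simp only [← hφ, Category.assoc] at huv ⊢
    rw [huv]
  · intro u
    obtain ⟨v, hv⟩ := (hyP N le_rfl W hW).surjective (c.inj N ≫ p ≫ u)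
    have hyv : ∀ n, y n ≫ v = c.inj n ≫ p ≫ u :=
      eq_of_eq_of_injective_comp (fun n hn => (hf n hn W hW).injective)
        (fun n => by rw [← Category.assoc, hy])
        (fun n => by
          have := comp_inj_succ_comp_milnor hM n =≫ u
          simpa only [Category.assoc] using this) hv
    refine ⟨v, milnor_hom_ext hM N
      (fun n hn => (hf n hn _ (P.le_shift (-1) W hW)).surjective) fun n => ?_⟩
    rw [← hyv, ← hφ, Category.assoc, Category.assoc]

end MilnorColimit

lemma IsMilnorColimit.of_iso {Y : ℕ → C} {f : ∀ n, Y n ⟶ Y (n + 1)} {M M' : C}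
    (hM : IsMilnorColimit Y f M) (e : M ≅ M') : IsMilnorColimit Y f M' := by
  obtain ⟨c, hc, p, d, hM⟩ := hM
  refine ⟨c, hc, p ≫ e.hom, e.inv ≫ d, isomorphic_distinguished _ hM _ ?_⟩
  exact Triangle.isoMk _ _ (Iso.refl _) (Iso.refl _) e.symm
    ((Category.comp_id _).trans (Category.id_comp _).symm)
    (show (p ≫ e.hom) ≫ e.inv = 𝟙 _ ≫ p by simp)
    (show (e.inv ≫ d) ≫ (𝟙 _)⟦(1 : ℤ)⟧' = e.inv ≫ d by simp)

lemma IsSuspended.prop_of_isMilnorColimit {P : ObjectProperty C} (hP : IsSuspended P)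
    (hP' : IsClosedUnderCoproducts P) {Y : ℕ → C} {f : ∀ n, Y n ⟶ Y (n + 1)} {A : C}
    (hY : ∀ n, P (Y n)) (hA : IsMilnorColimit Y f A) : P A := by
  obtain ⟨c, hc, p, d, hM⟩ := hA
  have := hP.closed_iso
  have := hP.closed_ext
  have := hP.closed_shift 1 one_pos
  have hcP : P c.pt := hP'.prop_pt hc hY
  exact P.ext_of_isTriangulatedClosed₂ _ (rot_of_distTriang _ hM) hcP (P.le_shift 1 _ hcP)

section TStructure

variable (t : Triangulated.TStructure C)

lemma le_eq_leftOrthogonal_ge (n : ℤ) : t.le n = (t.ge (n + 1)).leftOrthogonal := by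
  ext X
  simp only [t.le_iff_isLE, t.isLE_iff_orthogonal n (n + 1) rfl,
    ObjectProperty.leftOrthogonal_iff, t.ge_iff_isGE]

lemma le_isClosedUnderCoproducts (n : ℤ) : IsClosedUnderCoproducts (t.le n) := by
  rw [le_eq_leftOrthogonal_ge]
  exact leftOrthogonal_isClosedUnderCoproducts _

instance le_isTriangulatedClosed₂ (n : ℤ) : (t.le n).IsTriangulatedClosed₂ := by
  rw [le_eq_leftOrthogonal_ge]
  infer_instance

lemma le_isSuspended (n : ℤ) : IsSuspended (t.le n) where
  closed_iso := inferInstance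
  closed_ext := inferInstance
  closed_shift a ha :=
    ⟨fun X hX => t.le_monotone (by lia : n - a ≤ n) _ (t.le_shift n a (n - a) (by lia) X hX)⟩

instance ge_isStableUnderShiftBy_neg_one (n : ℤ) : (t.ge n).IsStableUnderShiftBy (-1 : ℤ) :=
  ⟨fun X hX => t.ge_antitone (by lia : n ≤ n + 1) _ (t.ge_shift n (-1) (n + 1) (by lia) X hX)⟩

lemma isLocal_ge_of_trW_le {k m : ℤ} (hkm : k + 1 < m) {X Y : C} {f : X ⟶ Y}
    (hf : (t.le k).trW f) : (t.ge m).isLocal f := by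
  obtain ⟨Z, g, h, hT, hZ⟩ := hf
  intro W hW
  have : t.IsLE Z k := ⟨hZ⟩
  have : t.IsLE (Z⟦(-1 : ℤ)⟧) (k + 1) := t.isLE_shift Z k (-1) (k + 1)
  have : t.IsGE W m := ⟨hW⟩
  constructor
  · intro u v huv
    have huv' : f ≫ (u - v) = 0 := by rw [Preadditive.comp_sub]; exact sub_eq_zero.2 huv
    obtain ⟨w, hw⟩ : ∃ w : Z ⟶ W, u - v = g ≫ w := Triangle.yoneda_exact₂ _ hT _ huv'
    rw [← sub_eq_zero, hw, t.zero w k m, comp_zero]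
  · intro u
    obtain ⟨v, hv⟩ : ∃ v : Y ⟶ W, u = f ≫ v :=
      Triangle.yoneda_exact₂ _ (inv_rot_of_distTriang _ hT) u
        (t.zero_of_isLE_of_isGE _ (k + 1) m hkm ‹t.IsLE (Z⟦(-1 : ℤ)⟧) (k + 1)› ‹t.IsGE W m›)
    exact ⟨v, hv.symm⟩

end TStructure

/-- `t` is the silting t-structure of `T`. -/
structure IsSiltingTStructure (t : Triangulated.TStructure C) (T : C) : Prop where
  le_zero_eq : t.le 0 = siltingAisle T
  ge_one_eq : t.ge 1 = siltingCoaisle T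

namespace IsSiltingTStructure

variable {t : Triangulated.TStructure C} {T : C} (ht : IsSiltingTStructure t T)
include ht

lemma le_neg_iff (k : ℤ) (X : C) : t.le (-k) X ↔ ∀ j < k, ∀ f : T⟦j⟧ ⟶ X, f = 0 := by
  rw [t.le_iff_isLE, ← t.isLE_shift_iff X (-k) (-k) 0, ← t.le_iff_isLE, ht.le_zero_eq,
    siltingAisle, rightPerp_singleton_iff]
  have e (j : ℤ) : T⟦-(k - j)⟧ ≅ T⟦j⟧⟦-k⟧ := (shiftFunctorAdd' C j (-k) (-(k - j)) (by lia)).app T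
  constructor
  · intro h j hj
    exact (forall_hom_shift_eq_zero_iff (e j) X).1 (h (k - j) (sub_pos.2 hj))
  · intro h i hi
    obtain ⟨j, rfl⟩ : ∃ j, i = k - j := ⟨k - i, by lia⟩
    exact (forall_hom_shift_eq_zero_iff (e j) X).2 (h j (sub_pos.1 hi))

lemma ge_one_iff (X : C) : t.ge 1 X ↔ ∀ j : ℤ, 0 ≤ j → ∀ f : T⟦j⟧ ⟶ X, f = 0 := by
  rw [ht.ge_one_eq, siltingCoaisle, rightPerp_singleton_iff]
  refine ⟨fun h j hj => ?_, fun h i hi => h (-i) (neg_nonneg.2 hi)⟩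
  obtain ⟨i, rfl⟩ : ∃ i, j = -i := ⟨-j, (neg_neg j).symm⟩
  exact h i (neg_nonneg.1 hj)

lemma le_zero : t.le 0 T := by
  rw [le_eq_leftOrthogonal_ge]
  intro Y f hY
  have e := (shiftFunctorZero C ℤ).app T
  rw [← cancel_epi e.hom, comp_zero]
  exact (ht.ge_one_iff Y).1 hY 0 le_rfl _

lemma le_neg_succ_iff (k : ℤ) (X : C) :
    t.le (-(k + 1)) X ↔ t.le (-k) X ∧ ∀ f : T⟦k⟧ ⟶ X, f = 0 := by
  simp only [ht.le_neg_iff, Int.lt_add_one_iff, le_iff_lt_or_eq, or_imp, forall_and, forall_eq]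

lemma isZero_of_forall_le {X : C} (hX : ∀ n, t.le n X) : IsZero X := by
  have : t.IsLE X 0 := ⟨hX 0⟩
  have : t.IsGE X 1 := ⟨(ht.ge_one_iff X).2 fun j _ =>
    ((ht.le_neg_succ_iff j X).1 (hX (-(j + 1)))).2⟩
  exact t.isZero X 0 1

lemma isIso_of_forall_isLocal_ge {X Y : C} {φ : X ⟶ Y} (hφ : ∀ m, (t.ge m).isLocal φ) :
    IsIso φ := by
  obtain ⟨Z, g, h, hT⟩ := distinguished_cocone_triangle φ
  refine (Triangle.isZero₃_iff_isIso₁ _ hT).1 (ht.isZero_of_forall_le fun n => ?_)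
  rw [le_eq_leftOrthogonal_ge]
  exact (ObjectProperty.trW_iff_of_distinguished _ _ hT).1
    (isLocal_le_trW_leftOrthogonal _ _ (hφ _))

variable [HasCoproducts.{v} C]

lemma exists_approximation {X : C} {k : ℤ} (hX : t.le (-k) X) :
    ∃ (K : C) (p : K ⟶ X), IsCoproductOfCopies (T⟦k⟧) K ∧ (t.le (-(k + 1))).trW p := by
  let p : (∐ fun _ : T⟦k⟧ ⟶ X => T⟦k⟧) ⟶ X := Sigma.desc fun u => u
  obtain ⟨Z, g, h, hT⟩ := distinguished_cocone_triangle p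
  have hK := isCoproductOfCopies_sigma (J := T⟦k⟧ ⟶ X) (T⟦k⟧)
  have hK₁ : t.le (-(k + 1)) ((∐ fun _ : T⟦k⟧ ⟶ X => T⟦k⟧)⟦(1 : ℤ)⟧) :=
    t.le_shift (-k) 1 _ (by lia) _ <| hK.prop (le_isClosedUnderCoproducts t (-k)) <|
      t.le_shift 0 k _ (by lia) _ ht.le_zero
  refine ⟨_, p, hK, Z, g, h, hT, (ht.le_neg_succ_iff k Z).2 ⟨?_, fun u => ?_⟩⟩
  · exact (t.le (-k)).ext_of_isTriangulatedClosed₂ _ (rot_of_distTriang _ hT) hX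
      (t.le_monotone (by lia) _ hK₁)
  · obtain ⟨w, rfl⟩ : ∃ w : T⟦k⟧ ⟶ X, u = w ≫ g :=
      Triangle.coyoneda_exact₃ _ hT u (((ht.le_neg_succ_iff k _).1 hK₁).2 _)
    have hw : Sigma.ι (fun _ : T⟦k⟧ ⟶ X => T⟦k⟧) w ≫ p = w := Sigma.ι_desc _ _
    have hpg : p ≫ g = 0 := comp_distTriang_mor_zero₁₂ _ hT
    rw [← hw, Category.assoc, hpg, comp_zero]

lemma exists_approximation_zero {X : C} (hX : t.le 0 X) :
    ∃ (K : C) (p : K ⟶ X), IsCoproductOfCopies T K ∧ (t.le (-1)).trW p := by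
  obtain ⟨K, p, hK, hp⟩ := ht.exists_approximation (k := 0) (by simpa using hX)
  exact ⟨K, p, hK.of_iso ((shiftFunctorZero C ℤ).symm.app T), by simpa using hp⟩

lemma leftOrthogonal_inf_le_zero_eq_addClosure :
    (t.le (-1)).leftOrthogonal ⊓ t.le 0 = addClosure (ObjectProperty.singleton T) := by
  apply le_antisymm
  · refine le_sInf ?_
    rintro P ⟨hP, hP', hT⟩ X ⟨hX, hX'⟩
    obtain ⟨K, p, hK, Z, g, h, hZ, hZ'⟩ := ht.exists_approximation_zero hX'
    obtain ⟨s, hs⟩ : ∃ s : X ⟶ K, 𝟙 X = s ≫ p :=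
      Triangle.coyoneda_exact₂ _ hZ (𝟙 X) (hX _ hZ')
    exact P.prop_of_retract ⟨s, p, hs.symm⟩ (hK.prop hP (hT T (by simp)))
  · refine sInf_le ⟨?_, ?_, ?_⟩
    · rw [le_eq_leftOrthogonal_ge t 0, ← leftOrthogonal_sup]
      exact leftOrthogonal_isClosedUnderCoproducts _
    · rw [le_eq_leftOrthogonal_ge t 0, ← leftOrthogonal_sup]
      infer_instance
    · rw [ObjectProperty.singleton_le_iff]
      refine ⟨fun Z f hZ => ?_, ht.le_zero⟩
      have e := (shiftFunctorZero C ℤ).app T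
      rw [← cancel_epi e.hom, comp_zero]
      exact (ht.le_neg_iff 1 Z).1 hZ 0 one_pos _

variable [IsTriangulated C]

lemma exists_tower_step {A Y : C} {y : Y ⟶ A} {k : ℤ} (hy : (t.le (-k)).trW y) :
    ∃ (Y' : C) (f : Y ⟶ Y') (y' : Y' ⟶ A), f ≫ y' = y ∧
      ObjectProperty.trW (IsCoproductOfCopies (T⟦k⟧)) f ∧ (t.le (-(k + 1))).trW y' := by
  obtain ⟨Z, g, h, hyZ, hZ⟩ := hy
  obtain ⟨K, p, hK, Z', q, r, hpq, hZ'⟩ := ht.exists_approximation hZ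
  obtain ⟨Y', y', w, hY'⟩ := distinguished_cocone_triangle₁ (g ≫ q)
  let o := Triangulated.someOctahedron' (rfl : g ≫ q = g ≫ q) hyZ hpq hY'
  exact ⟨Y', o.m₁, y', o.comm₁, ⟨K, o.m₃, _, o.mem, hK⟩, ⟨Z', _, w, hY', hZ'⟩⟩

lemma exists_tower {A : C} (hA : t.le 0 A) :
    ∃ (Y : ℕ → C) (f : ∀ n, Y n ⟶ Y (n + 1)) (y : ∀ n, Y n ⟶ A),
      IsCoproductOfCopies T (Y 0) ∧
      (∀ n : ℕ, ObjectProperty.trW (IsCoproductOfCopies (T⟦(n + 1 : ℤ)⟧)) (f n)) ∧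
      (∀ n, f n ≫ y (n + 1) = y n) ∧ ∀ n : ℕ, (t.le (-(n + 1))).trW (y n) := by
  obtain ⟨Y₀, y₀, hY₀, hy₀⟩ := ht.exists_approximation_zero hA
  choose Y' f y' hf hfT hy' using
    fun (n : ℕ) (s : {s : Over A // (t.le (-(n + 1))).trW s.hom}) => ht.exists_tower_step s.2
  let s (n : ℕ) : {s : Over A // (t.le (-(n + 1))).trW s.hom} :=
    Nat.rec ⟨Over.mk y₀, by simpa using hy₀⟩ (fun n s => ⟨Over.mk (y' n s), hy' n s⟩) n
  exact ⟨fun n => (s n).1.left, fun n => f n (s n), fun n => (s n).1.hom, hY₀,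
    fun n => hfT n (s n), fun n => hf n (s n), fun n => (s n).2⟩

theorem exists_isMilnorColimit {A : C} (hA : t.le 0 A) :
    ∃ (Y : ℕ → C) (f : ∀ n, Y n ⟶ Y (n + 1)),
      IsCoproductOfCopies T (Y 0) ∧
      (∀ n : ℕ, ObjectProperty.trW (IsCoproductOfCopies (T⟦(n + 1 : ℤ)⟧)) (f n)) ∧
      IsMilnorColimit Y f A := by
  obtain ⟨Y, f, y, hY₀, hf, hfy, hy⟩ := ht.exists_tower hA
  have := has_smallest_coproducts_of_hasCoproducts.{v} (C := C)
  have hc := coproductIsCoproduct Y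
  obtain ⟨M, p, d, hM⟩ := distinguished_cocone_triangle (oneSubShift f hc)
  obtain ⟨φ, hφ⟩ := exists_milnor_desc hM hfy
  have hφ_local (m : ℤ) : (t.ge m).isLocal φ :=
    isLocal_of_milnor hM (t.ge m) hfy (1 - m).toNat
      (fun n hn => isLocal_ge_of_trW_le t (by lia) (hy n)) hφ
  have : IsIso φ := ht.isIso_of_forall_isLocal_ge hφ_local
  exact ⟨Y, f, hY₀, hf, IsMilnorColimit.of_iso ⟨_, hc, p, d, hM⟩ (asIso φ)⟩

lemma le_zero_le_of_isSuspended {P : ObjectProperty C} (hP : IsSuspended P)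
    (hP' : IsClosedUnderCoproducts P) (hT : P T) : t.le 0 ≤ P := by
  intro A hA
  obtain ⟨Y, f, hY₀, hf, hYA⟩ := ht.exists_isMilnorColimit hA
  have := hP.closed_iso
  have := hP.closed_ext
  refine hP.prop_of_isMilnorColimit hP' (fun n => ?_) hYA
  induction n with
  | zero => exact hY₀.prop hP' hT
  | succ n ih =>
    obtain ⟨K, g, h, hK, hKT⟩ := hf n
    have := hP.closed_shift (n + 1) (by lia)
    exact P.ext_of_isTriangulatedClosed₂ _ hK ih (hKT.prop hP' (P.le_shift _ _ hT))

lemma le_zero_eq_susp : t.le 0 = susp (ObjectProperty.singleton T) := by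
  apply le_antisymm
  · refine le_sInf ?_
    rintro P ⟨hP, hP', hT⟩
    exact ht.le_zero_le_of_isSuspended hP hP' (hT T (by simp))
  · exact sInf_le ⟨le_isSuspended t 0, le_isClosedUnderCoproducts t 0,
      ObjectProperty.singleton_le_iff.2 ht.le_zero⟩

lemma isLeast_le_zero : IsLeast {V : ObjectProperty C | IsAisle V ∧ V T} (t.le 0) := by
  refine ⟨⟨⟨t.ge 1, t, rfl, rfl⟩, ht.le_zero⟩, ?_⟩
  rintro _ ⟨⟨_, t', rfl, -⟩, hT⟩
  exact ht.le_zero_le_of_isSuspended (le_isSuspended t' 0) (le_isClosedUnderCoproducts t' 0) hT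

end IsSiltingTStructure

lemma leftPerp_le_zero_shift (t : Triangulated.TStructure C) :
    (leftPerp (t.le 0) {0}).shift (-1 : ℤ) = (t.le (-1)).leftOrthogonal := by
  rw [leftPerp_zero, leftOrthogonal_shift, t.shift_le (-1) 0 (-1) (by lia)]

end Pretriangulated

end Silting

theorem mainTheorem8 {C : Type u} [Category.{v} C] [Preadditive C] [HasZeroObject C]
    [HasShift C ℤ] [∀ n : ℤ, (shiftFunctor C n).Additive] [Pretriangulated C]
    [IsTriangulated C] [HasCoproducts.{v} C]
    (T : C) (hT : Silting.IsSilting T)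
    (V W : ObjectProperty C)
    (hV : V = Silting.siltingAisle T) (hW : W = Silting.siltingCoaisle T) :
    -- the aisle is `Susp(T)`, and it is the smallest aisle that contains `T`
    (V = Silting.susp (ObjectProperty.singleton T) ∧
      IsLeast {V' : ObjectProperty C | Silting.IsAisle V' ∧ V' T} V) ∧
    -- truncations are Milnor colimits
    (∀ X A : C, Silting.IsTruncation V W X A →
      ∃ (Y : ℕ → C) (f : ∀ n, Y n ⟶ Y (n + 1)),
        Silting.IsCoproductOfCopies T (Y 0) ∧
        (∀ n : ℕ, ∃ (K : C) (g : Y (n + 1) ⟶ K) (h : K ⟶ (Y n)⟦(1 : ℤ)⟧),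
          Triangle.mk (f n) g h ∈ distTriang C ∧
          Silting.IsCoproductOfCopies (T⟦(n + 1 : ℤ)⟧) K) ∧
        Silting.IsMilnorColimit Y f A) ∧
    -- `U[1] ∩ V = Add(T)` for `U` the left orthogonal class of `V`
    (Silting.leftPerp V {0}).shift (-1 : ℤ) ⊓ V =
      Silting.addClosure (ObjectProperty.singleton T) := by
  subst hV hW
  obtain ⟨t, hle, hge⟩ := hT
  have ht : Silting.IsSiltingTStructure t T := ⟨hle, hge⟩
  rw [← hle, Silting.leftPerp_le_zero_shift]
  refine ⟨⟨ht.le_zero_eq_susp, ht.isLeast_le_zero⟩, fun X A hA => ?_,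
    ht.leftOrthogonal_inf_le_zero_eq_addClosure⟩
  simpa [ObjectProperty.trW_iff] using ht.exists_isMilnorColimit hA.1
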